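/- Let $d\ge 2$ be an integer and let $\mathcal{M}_d$ be the $d$-th multibrot set, i.e. the set of all $t\in\mathbb{C}$ such that the orbit of $0$ under the map $z\mapsto z^d+t$ is bounded. If $A,B\in\mathbb{C}$ and the affine map $\mu(z)=Az+B$ satisfies $\mu(\mathcal{M}_d)=\mathcal{M}_d$, then $B=0$ and $A$ is a $(d-1)$-st root of unity, that is, $A^{d-1}=1$. Conversely, for every $\xi\in\mathbb{C}$ with $\xi^{d-1}=1$, the rotation $z\mapsto \xi z$ maps $\mathcal{M}_d$ onto itself. -/

import Mathlib

/-- The `d`-th multibrot set: all `t : ℂ` such that the orbit of `0` under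
`z ↦ z ^ d + t` is bounded. -/
def multibrot (d : ℕ) : Set ℂ :=
  {t : ℂ | Bornology.IsBounded (Set.range fun n : ℕ => (fun z : ℂ => z ^ d + t)^[n] 0)}

open Polynomial Filter Bornology Asymptotics Topology Pointwise

/-! ### Polynomials near infinity -/

/-! Write P_n for the orbit polynomials in `t`: monic of degree d^n, with M_d the decreasing
intersection of the lemniscates |P_n| ≤ 2. Comparing diameters gives |A| = 1.

If μ maps M_d into itself, a late lemniscate of P_{n+i} lies in {|P_n ∘ μ| < 3}. The maximum
principle outside it bounds |P_n ∘ μ|^(d^i) by 3^(d^i) |P_{n+i}| (`norm_orbitPoly_affine_le`). Near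
infinity |P_{n+j}| is |P_n|^(d^j) up to an error inside the power (`norm_orbitPoly_distortion`).
Taking roots removes the constant, so |P_n ∘ μ| ≤ |P_n| + o(1) for n ≥ 1. This is a finite form of
comparing Green's functions of M_d.

Two polynomials of equal degree related in this way are proportional (`eq_C_mul_of_norm_eval_le`),
hence P_n ∘ μ = A^(d^n) P_n. The cases n = 1, 2 with the recursion P_2 = P_1^d + t force μ to be
linear, and then n = 1 gives A^(d-1) = 1. -/

theorem tendsto_eval_div_cobounded {p q : ℂ[X]} (hq : q ≠ 0) (h : p.natDegree = q.natDegree) :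
    Tendsto (fun t => p.eval t / q.eval t) (cobounded ℂ)
      (𝓝 (p.leadingCoeff / q.leadingCoeff)) := by
  have e := (isEquivalent_cobounded_leading_monomial (P := p)).div
    (isEquivalent_cobounded_leading_monomial (P := q))
  refine e.symm.tendsto_nhds (tendsto_const_nhds.congr' ?_)
  filter_upwards [eventually_ne_cobounded (0 : ℂ)] with t ht
  have : t ^ q.natDegree ≠ 0 := pow_ne_zero _ ht
  have : q.leadingCoeff ≠ 0 := leadingCoeff_ne_zero.mpr hq
  simp only [h, Pi.div_apply]
  field_simp

/-- If `q` differs from `l * p`, `‖l‖ = 1`, by a polynomial of smaller degree, and `‖q‖` exceeds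
`‖p‖` near infinity by no more than a quantity that tends to zero, then `q = l * p`. -/
theorem eq_C_mul_of_norm_eval_le {p q : ℂ[X]} {l : ℂ} (hl : ‖l‖ = 1) (hp : p ≠ 0)
    (hdeg : (q - C l * p).degree < p.degree) {ε : ℂ → ℝ} (hε : Tendsto ε (cobounded ℂ) (𝓝 0))
    (h : ∀ᶠ t in cobounded ℂ, ‖q.eval t‖ ≤ ‖p.eval t‖ + ε t) : q = C l * p := by
  by_contra hne
  set D := q - C l * p with hD
  have hD0 : D ≠ 0 := sub_ne_zero.mpr hne
  have hl0 : l ≠ 0 := by rintro rfl; simp at hl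
  have hlt : D.natDegree < p.natDegree := natDegree_lt_natDegree hD0 hdeg
  obtain ⟨j, hj⟩ : ∃ j, p.natDegree = D.natDegree + j := ⟨_, (Nat.add_sub_cancel' hlt.le).symm⟩
  have hj0 : 0 < j := by omega
  set b : ℂ := (X ^ j * D).leadingCoeff / (C l * p).leadingCoeff with hb
  have hb0 : b ≠ 0 := by
    simp [hb, hD0, hp, hl0]
  have hF : Tendsto (fun t => (X ^ j * D).eval t / (C l * p).eval t) (cobounded ℂ) (𝓝 b) := by
    refine tendsto_eval_div_cobounded (by simp [hp, hl0]) ?_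
    rw [natDegree_C_mul hl0, natDegree_mul (by simp) hD0, natDegree_X_pow, hj, add_comm]
  -- Since D / (l p) ~ b / t^j, this quotient is asymptotically the positive number r^(-j) along the
  -- ray t = rω. There ‖q‖ exceeds ‖p‖ by about r^(-j) ‖p‖, which does not tend to zero because j ≤
  -- deg p.
  obtain ⟨ω, hω⟩ := IsAlgClosed.exists_pow_nat_eq b hj0
  have hω0 : ω ≠ 0 := by rintro rfl; exact hb0 (by rw [← hω, zero_pow hj0.ne'])
  have hray : Tendsto (fun r : ℝ => (r : ℂ) * ω) atTop (cobounded ℂ) := by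
    rw [← tendsto_norm_atTop_iff_cobounded]
    simp only [norm_mul, Complex.norm_real]
    exact (tendsto_norm_atTop_atTop).atTop_mul_const (norm_pos_iff.mpr hω0)
  have hre : Tendsto (fun r : ℝ => ((X ^ j * D).eval (r * ω) / (C l * p).eval (r * ω) / b).re)
      atTop (𝓝 1) := by
    have := (hF.comp hray).div_const b
    rw [div_self hb0] at this
    exact (Complex.continuous_re.tendsto 1).comp this
  have hsmall : Tendsto (fun t : ℂ => ‖t‖ ^ j * ε t / ‖p.eval t‖) (cobounded ℂ) (𝓝 0) := by
    have h1 : (X ^ j : ℂ[X]).eval =O[cobounded ℂ] p.eval := by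
      apply isBigO_cobounded_of_degree_le
      rw [degree_X_pow, degree_eq_natDegree hp]
      exact_mod_cast (by omega : j ≤ p.natDegree)
    have h2 : ε =o[cobounded ℂ] (fun _ => (1 : ℝ)) := (isLittleO_one_iff ℝ).mpr hε
    have h3 := h1.norm_norm.mul_isLittleO h2
    simp only [mul_one] at h3
    simpa using h3.tendsto_div_nhds_zero
  have hsmall' := (hsmall.comp hray).div_const ‖b‖
  rw [zero_div] at hsmall'
  have hcontra : (1 : ℝ) ≤ 0 := by
    refine le_of_tendsto_of_tendsto hre hsmall' ?_
    have hp0 : ∀ᶠ t in cobounded ℂ, p.eval t ≠ 0 := by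
      have := tendsto_norm_atTop (p := p) (natDegree_pos_iff_degree_pos.mp (by omega))
        tendsto_norm_cobounded_atTop
      filter_upwards [this.eventually_gt_atTop 0] with t ht
      exact norm_pos_iff.mp ht
    filter_upwards [hray.eventually h, hray.eventually hp0, eventually_gt_atTop 0]
      with r h1 h2 hr
    set t : ℂ := r * ω with ht
    have hrj : t ^ j = (r : ℂ) ^ j * b := by rw [ht, mul_pow, hω]
    have hnp : 0 < ‖p.eval t‖ := norm_pos_iff.mpr h2
    have hq : q.eval t = l * p.eval t * (1 + D.eval t / (l * p.eval t)) := by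
      simp only [hD, eval_sub, eval_mul, eval_C]
      field_simp
      ring
    have hle : (D.eval t / (l * p.eval t)).re ≤ ε t / ‖p.eval t‖ := by
      have h3 : ‖1 + D.eval t / (l * p.eval t)‖ ≤ 1 + ε t / ‖p.eval t‖ := by
        rw [hq, norm_mul, norm_mul, hl, one_mul] at h1
        rw [← mul_le_mul_iff_right₀ hnp]
        refine h1.trans_eq ?_
        field_simp
      have h4 := (Complex.re_le_norm _).trans h3
      simpa using h4
    have e1 : (X ^ j * D).eval t / (C l * p).eval t / b
        = ((r ^ j : ℝ) : ℂ) * (D.eval t / (l * p.eval t)) := by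
      simp only [eval_mul, eval_pow, eval_X, eval_C, hrj]
      push_cast
      field_simp
    have e2 : ‖t‖ ^ j = r ^ j * ‖b‖ := by
      rw [← norm_pow, hrj, norm_mul, norm_pow, Complex.norm_real, Real.norm_of_nonneg hr.le]
    have hbp : 0 < ‖b‖ := norm_pos_iff.mpr hb0
    simp only [Function.comp_apply, ← ht]
    rw [e1, Complex.re_ofReal_mul, e2]
    calc r ^ j * (D.eval t / (l * p.eval t)).re ≤ r ^ j * (ε t / ‖p.eval t‖) := by gcongr
      _ = _ := by field_simp
  norm_num at hcontra

/-- The maximum principle outside a lemniscate of `p`, for the quotient of two polynomials of the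
same degree. -/
theorem norm_eval_le_of_lemniscate {p q : ℂ[X]} (hp : 0 < p.natDegree)
    (hdeg : q.natDegree = p.natDegree) (hlc : ‖q.leadingCoeff‖ = ‖p.leadingCoeff‖) {R K : ℝ}
    (hR : 0 < R) (hK : 1 < K) (h : ∀ t, ‖p.eval t‖ = R → ‖q.eval t‖ ≤ K * R) {t : ℂ}
    (ht : R < ‖p.eval t‖) : ‖q.eval t‖ ≤ K * ‖p.eval t‖ := by
  have hp0 : p ≠ 0 := by rintro rfl; simp at hp
  have hlim : Tendsto (fun t => ‖q.eval t / p.eval t‖) (cobounded ℂ) (𝓝 1) := by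
    have := (tendsto_eval_div_cobounded hp0 hdeg).norm
    rwa [norm_div, hlc, div_self (norm_ne_zero_iff.mpr (leadingCoeff_ne_zero.mpr hp0))] at this
  have hev : ∀ᶠ t in cobounded ℂ, ‖q.eval t / p.eval t‖ ≤ K :=
    (hlim.eventually_lt_const hK).mono fun _ => le_of_lt
  rw [← comap_norm_atTop] at hev
  obtain ⟨s, hs, hsub⟩ := hev
  obtain ⟨r₀, hr₀⟩ := mem_atTop_sets.mp hs
  set r := max r₀ (‖t‖ + 1)
  set U : Set ℂ := {z | R < ‖p.eval z‖} ∩ Metric.ball 0 r with hU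
  have hpc : Continuous fun z => ‖p.eval z‖ := p.continuous.norm
  have hopen : IsOpen U := (isOpen_lt continuous_const hpc).inter Metric.isOpen_ball
  have hcl : closure U ⊆ {z | R ≤ ‖p.eval z‖} ∩ Metric.closedBall 0 r :=
    closure_minimal (Set.inter_subset_inter (fun z (hz : R < _) => hz.le)
      Metric.ball_subset_closedBall)
      ((isClosed_le continuous_const hpc).inter Metric.isClosed_closedBall)
  have htU : t ∈ U := ⟨ht, by
    rw [mem_ball_zero_iff]; exact (lt_add_one _).trans_le (le_max_right _ _)⟩
  have hd : DiffContOnCl ℂ (fun z => q.eval z / p.eval z) U := by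
    refine DifferentiableOn.diffContOnCl fun z hz => ?_
    refine (q.differentiableAt.div p.differentiableAt ?_).differentiableWithinAt
    exact norm_pos_iff.mp (hR.trans_le (hcl hz).1)
  have hfr : ∀ z ∈ frontier U, ‖q.eval z / p.eval z‖ ≤ K := by
    intro z hz
    have hzc := hcl (frontier_subset_closure hz)
    have hzU : z ∉ U := by
      rw [hopen.frontier_eq] at hz
      exact hz.2
    have hz1 : R ≤ ‖p.eval z‖ := hzc.1
    have hz2 : ‖z‖ ≤ r := mem_closedBall_zero_iff.mp hzc.2
    rcases hz1.eq_or_lt with he | hlt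
    · rw [norm_div, ← he, div_le_iff₀ hR]
      exact h z he.symm
    · have : ¬ ‖z‖ < r := fun hzr => hzU ⟨hlt, mem_ball_zero_iff.mpr hzr⟩
      exact hsub (hr₀ _ ((le_max_left _ _).trans (not_lt.mp this)))
  have := Complex.norm_le_of_forall_mem_frontier_norm_le
    (Metric.isBounded_ball.subset Set.inter_subset_right) hd hfr (subset_closure htU)
  rwa [norm_div, div_le_iff₀ (hR.trans ht)] at this

/-! ### The critical orbit as a sequence of polynomials in the parameter -/

/-- The polynomial in `t` whose value is the `(n + 1)`-st iterate of `z ↦ z ^ d + t` at `0`. -/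
noncomputable def orbitPoly (d : ℕ) : ℕ → ℂ[X]
  | 0 => X
  | n + 1 => orbitPoly d n ^ d + X

theorem orbitPoly_eval_succ (d n : ℕ) (t : ℂ) :
    (orbitPoly d (n + 1)).eval t = (orbitPoly d n).eval t ^ d + t := by
  simp [orbitPoly]

theorem orbitPoly_eval {d : ℕ} (hd : 2 ≤ d) (n : ℕ) (t : ℂ) :
    (orbitPoly d n).eval t = (fun z : ℂ => z ^ d + t)^[n + 1] 0 := by
  induction n with
  | zero => simp [orbitPoly, zero_pow (by omega : d ≠ 0)]
  | succ n ih => rw [orbitPoly_eval_succ, ih, Function.iterate_succ_apply' _ (n + 1)]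

theorem orbitPoly_monic_natDegree {d : ℕ} (hd : 2 ≤ d) (n : ℕ) :
    (orbitPoly d n).Monic ∧ (orbitPoly d n).natDegree = d ^ n := by
  induction n with
  | zero => exact ⟨monic_X, by simp [orbitPoly]⟩
  | succ n ih =>
    obtain ⟨hm, hn⟩ := ih
    have hm' := hm.pow d
    have hn' : (orbitPoly d n ^ d).natDegree = d ^ (n + 1) := by
      rw [hm.natDegree_pow, hn, pow_succ, mul_comm]
    have hlt : (X : ℂ[X]).natDegree < (orbitPoly d n ^ d).natDegree := by
      rw [hn', natDegree_X]
      exact Nat.one_lt_pow (by omega) (by omega)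
    refine ⟨?_, ?_⟩
    · exact hm'.add_of_left (degree_lt_degree hlt)
    · rw [orbitPoly, natDegree_add_eq_left_of_natDegree_lt hlt, hn']

theorem sub_le_norm_orbitPoly_succ (d n : ℕ) (t : ℂ) :
    ‖(orbitPoly d n).eval t‖ ^ d - ‖t‖ ≤ ‖(orbitPoly d (n + 1)).eval t‖ := by
  rw [orbitPoly_eval_succ, ← norm_pow]
  exact norm_sub_le_norm_add _ _

theorem norm_orbitPoly_succ_le (d n : ℕ) (t : ℂ) :
    ‖(orbitPoly d (n + 1)).eval t‖ ≤ ‖(orbitPoly d n).eval t‖ ^ d + ‖t‖ := by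
  rw [orbitPoly_eval_succ, ← norm_pow]
  exact norm_add_le _ _

theorem mul_norm_orbitPoly_le_succ {d : ℕ} (hd : 2 ≤ d) {n : ℕ} {t : ℂ}
    (h2 : 2 ≤ ‖(orbitPoly d n).eval t‖) (ht : ‖t‖ ≤ ‖(orbitPoly d n).eval t‖) :
    (‖(orbitPoly d n).eval t‖ - 1) * ‖(orbitPoly d n).eval t‖
      ≤ ‖(orbitPoly d (n + 1)).eval t‖ := by
  have h1 := sub_le_norm_orbitPoly_succ d n t
  have : ‖(orbitPoly d n).eval t‖ ^ 2 ≤ ‖(orbitPoly d n).eval t‖ ^ d :=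
    pow_le_pow_right₀ (by linarith) hd
  nlinarith

theorem norm_le_norm_orbitPoly {d : ℕ} (hd : 2 ≤ d) {t : ℂ} (ht : 2 ≤ ‖t‖) (n : ℕ) :
    ‖t‖ ≤ ‖(orbitPoly d n).eval t‖ := by
  induction n with
  | zero => simp [orbitPoly]
  | succ n ih => nlinarith [mul_norm_orbitPoly_le_succ hd (ht.trans ih) ih]

theorem norm_orbitPoly_monotone {d : ℕ} (hd : 2 ≤ d) {t : ℂ} (ht : 2 ≤ ‖t‖) :
    Monotone fun n => ‖(orbitPoly d n).eval t‖ := by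
  refine monotone_nat_of_le_succ fun n => ?_
  have ih := norm_le_norm_orbitPoly hd ht n
  nlinarith [mul_norm_orbitPoly_le_succ hd (ht.trans ih) ih]

/-- 2 is an escape radius for every parameter: beyond it the orbit also dominates ‖t‖, so each step
multiplies the modulus by at least a fixed factor > 1. -/
theorem norm_orbitPoly_growth {d : ℕ} (hd : 2 ≤ d) {k : ℕ} {t : ℂ}
    (h : 2 < ‖(orbitPoly d k).eval t‖) (j : ℕ) :
    2 < ‖(orbitPoly d (k + j)).eval t‖ ∧
      (‖(orbitPoly d k).eval t‖ - 1) ^ j * ‖(orbitPoly d k).eval t‖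
        ≤ ‖(orbitPoly d (k + j)).eval t‖ := by
  have hge : ∀ m, 2 < ‖(orbitPoly d m).eval t‖ → ‖t‖ ≤ ‖(orbitPoly d m).eval t‖ := by
    intro m hm
    rcases le_total 2 ‖t‖ with ht | ht
    · exact norm_le_norm_orbitPoly hd ht m
    · linarith
  suffices ‖(orbitPoly d k).eval t‖ ≤ ‖(orbitPoly d (k + j)).eval t‖ ∧
      (‖(orbitPoly d k).eval t‖ - 1) ^ j * ‖(orbitPoly d k).eval t‖
        ≤ ‖(orbitPoly d (k + j)).eval t‖ from ⟨by linarith, this.2⟩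
  induction j with
  | zero => simp
  | succ j ih =>
    obtain ⟨h1, h2⟩ := ih
    have h3 := mul_norm_orbitPoly_le_succ hd (h.trans_le h1).le (hge _ (h.trans_le h1))
    rw [← add_assoc]
    refine ⟨by nlinarith, le_trans ?_ h3⟩
    rw [pow_succ', mul_assoc]
    exact mul_le_mul (by linarith) h2 (mul_nonneg (pow_nonneg (by linarith) _) (norm_nonneg _))
      (by linarith)

theorem mem_multibrot_iff {d : ℕ} (hd : 2 ≤ d) {t : ℂ} :
    t ∈ multibrot d ↔ ∀ n, ‖(orbitPoly d n).eval t‖ ≤ 2 := by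
  rw [multibrot, Set.mem_ofPred_eq, isBounded_iff_forall_norm_le]
  simp only [Set.forall_mem_range]
  constructor
  · rintro ⟨K, hK⟩ k
    by_contra! h
    obtain ⟨j, hj⟩ := pow_unbounded_of_one_lt K
      (by linarith : 1 < ‖(orbitPoly d k).eval t‖ - 1)
    have h1 := (norm_orbitPoly_growth hd h j).2
    have h2 := hK (k + j + 1)
    rw [← orbitPoly_eval hd] at h2
    have h3 : 0 < (‖(orbitPoly d k).eval t‖ - 1) ^ j := pow_pos (by linarith) _
    nlinarith
  · intro h
    refine ⟨2, fun n => ?_⟩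
    cases n with
    | zero => simp
    | succ n => rw [← orbitPoly_eval hd]; exact h n

/-- The sublevel sets of the orbit polynomials shrink to the multibrot set. -/
theorem exists_lemniscate_subset {d : ℕ} (hd : 2 ≤ d) (n : ℕ) {U : Set ℂ} (hU : IsOpen U)
    (hM : multibrot d ⊆ U) : ∃ i, {t | ‖(orbitPoly d (n + i)).eval t‖ ≤ 2} ⊆ U := by
  have hanti : Antitone fun i => {t : ℂ | ‖(orbitPoly d (n + i)).eval t‖ ≤ 2} := by
    refine antitone_nat_of_succ_le fun i t ht => ?_
    by_contra h
    exact absurd (norm_orbitPoly_growth hd (not_le.mp h) 1).1 (not_lt.mpr ht)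
  refine exists_subset_nhds_of_isCompact hanti.directed_ge (fun i => ?_) fun t ht =>
    hU.mem_nhds (hM ?_)
  · refine (isCompact_closedBall (0 : ℂ) 2).of_isClosed_subset
      (isClosed_le (orbitPoly d (n + i)).continuous.norm continuous_const) fun t ht => ?_
    rw [mem_closedBall_zero_iff]
    by_contra! h
    exact absurd (h.trans_le (norm_le_norm_orbitPoly hd h.le (n + i))) (not_lt.mpr ht)
  · rw [mem_multibrot_iff hd]
    intro m
    by_contra! h
    have := (norm_orbitPoly_growth hd h n).1
    rw [add_comm] at this
    exact absurd this (not_lt.mpr (Set.mem_iInter.mp ht m))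

/-! ### Size of the orbit polynomials near infinity -/

/-- The correction by which `‖orbitPoly d n‖` determines all later orbit polynomials near
infinity, in the sense of `norm_orbitPoly_distortion`. -/
noncomputable def orbitError (d n : ℕ) (t : ℂ) : ℝ :=
  2 * ‖t‖ / ‖(orbitPoly d n).eval t‖ ^ (d - 1)

theorem orbitError_nonneg (d n : ℕ) (t : ℂ) : 0 ≤ orbitError d n t := by
  unfold orbitError; positivity

theorem orbitError_le_norm {d : ℕ} (hd : 2 ≤ d) (n : ℕ) {t : ℂ} (ht : 2 ≤ ‖t‖) :
    orbitError d n t ≤ ‖t‖ := by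
  have h := ht.trans (norm_le_norm_orbitPoly hd ht n)
  have h1 : ‖(orbitPoly d n).eval t‖ ≤ ‖(orbitPoly d n).eval t‖ ^ (d - 1) :=
    le_self_pow₀ (by linarith) (by omega)
  rw [orbitError, div_le_iff₀ (by linarith)]
  nlinarith

/-- With c the error and x ≥ ‖P_n‖, (x + c)^d exceeds x^d by at least c x^(d-1) ≥ 2‖t‖. One ‖t‖ pays
for the added parameter, the other for carrying c ≤ ‖t‖ to the next step. The lower bound is
symmetric. -/
theorem norm_orbitPoly_distortion {d : ℕ} (hd : 2 ≤ d) (n : ℕ) {t : ℂ} (ht : 2 ≤ ‖t‖) (j : ℕ) :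
    ‖(orbitPoly d (n + j)).eval t‖ + orbitError d n t
        ≤ (‖(orbitPoly d n).eval t‖ + orbitError d n t) ^ d ^ j ∧
      (‖(orbitPoly d n).eval t‖ - orbitError d n t) ^ d ^ j
        ≤ ‖(orbitPoly d (n + j)).eval t‖ - orbitError d n t := by
  have hc0 := orbitError_nonneg d n t
  have hct := orbitError_le_norm hd n ht
  have ha := norm_le_norm_orbitPoly hd ht n
  have hca : orbitError d n t * ‖(orbitPoly d n).eval t‖ ^ (d - 1) = 2 * ‖t‖ := by
    rw [orbitError, div_mul_cancel₀]
    exact pow_ne_zero _ (by linarith)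
  generalize orbitError d n t = c at *
  induction j with
  | zero => simp
  | succ j ih =>
    obtain ⟨h1, h2⟩ := ih
    have hmono : ‖(orbitPoly d n).eval t‖ ≤ ‖(orbitPoly d (n + j)).eval t‖ :=
      norm_orbitPoly_monotone hd ht (Nat.le_add_right n j)
    have hup := norm_orbitPoly_succ_le d (n + j) t
    have hlo := sub_le_norm_orbitPoly_succ d (n + j) t
    have hsucc : n + (j + 1) = n + j + 1 := rfl
    rw [hsucc]
    set x := ‖(orbitPoly d (n + j)).eval t‖
    obtain ⟨e, rfl⟩ : ∃ e, d = e + 1 := ⟨d - 1, by omega⟩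
    simp only [Nat.add_sub_cancel] at hca
    have hx : 0 ≤ x := norm_nonneg _
    have hcx : 2 * ‖t‖ ≤ c * x ^ e := by rw [← hca]; gcongr
    rw [pow_succ (e + 1) j, pow_mul, pow_mul]
    constructor
    · have h3 : x ^ (e + 1) + c * x ^ e ≤ (x + c) ^ (e + 1) := by
        have : x ^ e ≤ (x + c) ^ e := by gcongr; linarith
        rw [pow_succ, pow_succ]
        nlinarith
      have h4 := pow_le_pow_left₀ (by linarith) h1 (e + 1)
      linarith
    · have h3 : (x - c) ^ (e + 1) ≤ x ^ (e + 1) - c * x ^ e := by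
        have : (x - c) ^ e ≤ x ^ e := by gcongr <;> linarith
        rw [pow_succ, pow_succ]
        nlinarith
      have h4 := pow_le_pow_left₀ (pow_nonneg (by linarith) _) h2 (e + 1)
      linarith

/-- The denominator has degree (d-1)d^n, which exceeds 1 once n ≥ 1; for d = 2, n = 0 the error
would stay equal to 2. -/
theorem tendsto_orbitError {d n : ℕ} (hd : 2 ≤ d) (hn : n ≠ 0) :
    Tendsto (orbitError d n) (cobounded ℂ) (𝓝 0) := by
  obtain ⟨hm, hdeg⟩ := orbitPoly_monic_natDegree hd n
  have h1 : (X : ℂ[X]).degree < (orbitPoly d n ^ (d - 1)).degree := by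
    refine degree_lt_degree ?_
    rw [natDegree_X, hm.natDegree_pow, hdeg]
    have := Nat.one_lt_pow hn (by omega : 1 < d)
    have : 1 ≤ d - 1 := by omega
    nlinarith
  have h2 := ((isLittleO_cobounded_of_degree_lt h1).norm_norm.tendsto_div_nhds_zero).const_mul 2
  rw [mul_zero] at h2
  refine h2.congr fun t => ?_
  simp [orbitError, mul_div_assoc]

/-! ### Affine maps preserving the multibrot set -/

theorem norm_orbitPoly_affine_le {d : ℕ} (hd : 2 ≤ d) {A B : ℂ} (hA : ‖A‖ = 1)
    (hM : ∀ t ∈ multibrot d, A * t + B ∈ multibrot d) (n : ℕ) :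
    ∃ i, ∀ t, 2 < ‖(orbitPoly d (n + i)).eval t‖ →
      ‖(orbitPoly d n).eval (A * t + B)‖ ^ d ^ i
        ≤ 3 ^ d ^ i * ‖(orbitPoly d (n + i)).eval t‖ := by
  have hA0 : A ≠ 0 := by rintro rfl; simp at hA
  obtain ⟨i, hi⟩ := exists_lemniscate_subset hd n
    (U := {t | ‖(orbitPoly d n).eval (A * t + B)‖ < 3})
    (isOpen_lt (by fun_prop) continuous_const)
    (fun t ht => ((mem_multibrot_iff hd).mp (hM t ht) n).trans_lt (by norm_num))
  refine ⟨i, fun t ht => ?_⟩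
  obtain ⟨hm, hdeg⟩ := orbitPoly_monic_natDegree hd n
  obtain ⟨hm', hdeg'⟩ := orbitPoly_monic_natDegree hd (n + i)
  set q := ((orbitPoly d n).comp (C A * X + C B)) ^ d ^ i with hq
  have hqe : ∀ z, ‖q.eval z‖ = ‖(orbitPoly d n).eval (A * z + B)‖ ^ d ^ i := fun z => by
    simp [hq, eval_comp]
  have hdi : d ^ i ≠ 0 := pow_ne_zero _ (by omega)
  have hlin : (C A * X + C B).natDegree = 1 := natDegree_linear hA0
  have key := norm_eval_le_of_lemniscate (p := orbitPoly d (n + i)) (q := q) (R := 2)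
    (K := 3 ^ d ^ i) (by rw [hdeg']; exact pow_pos (by omega) _) ?_ ?_ two_pos
    (one_lt_pow₀ (by norm_num) hdi) ?_ ht
  · rwa [hqe] at key
  · rw [hq, natDegree_pow, natDegree_comp, hlin, hdeg, hdeg', pow_add]
    ring
  · rw [hq, leadingCoeff_pow, leadingCoeff_comp (by rw [hlin]; exact one_ne_zero),
      leadingCoeff_linear hA0, hm.leadingCoeff, hm'.leadingCoeff]
    simp [hA]
  · intro z hz
    rw [hqe]
    have h3 : ‖(orbitPoly d n).eval (A * z + B)‖ < 3 := hi (le_of_eq hz)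
    have h4 := pow_le_pow_left₀ (norm_nonneg _) h3.le (d ^ i)
    have : (0 : ℝ) < 3 ^ d ^ i := by positivity
    linarith

theorem le_of_forall_pow_le {u v K : ℝ} (hv : 0 < v) {d : ℕ} (hd : 2 ≤ d)
    (h : ∀ i : ℕ, u ^ d ^ i ≤ K * v ^ d ^ i) : u ≤ v := by
  by_contra! huv
  have h1 : 1 < u / v := (one_lt_div hv).mpr huv
  obtain ⟨i, hi⟩ := pow_unbounded_of_one_lt K h1
  have h2 : (u / v) ^ i ≤ (u / v) ^ d ^ i :=
    pow_le_pow_right₀ h1.le (Nat.lt_pow_self (by omega)).le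
  have h3 : (u / v) ^ d ^ i ≤ K := by
    rw [div_pow, div_le_iff₀ (pow_pos hv _)]
    exact h i
  linarith

theorem norm_orbitPoly_affine_sub_le {d : ℕ} (hd : 2 ≤ d) {A B : ℂ} (hA : ‖A‖ = 1)
    (hM : ∀ t ∈ multibrot d, A * t + B ∈ multibrot d) (n : ℕ) {t : ℂ} (ht : 2 < ‖t‖)
    (ht' : 2 ≤ ‖A * t + B‖) :
    ‖(orbitPoly d n).eval (A * t + B)‖ - orbitError d n (A * t + B)
      ≤ ‖(orbitPoly d n).eval t‖ + orbitError d n t := by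
  have hc := orbitError_nonneg d n t
  have hc' := orbitError_nonneg d n (A * t + B)
  have ha := norm_le_norm_orbitPoly hd ht.le n
  have ha' := norm_le_norm_orbitPoly hd ht' n
  have hct' := orbitError_le_norm hd n ht'
  refine le_of_forall_pow_le (K := 3) (by linarith) hd fun i => ?_
  -- Here j depends on i, but the d^j-th root turns 3^(d^j) into 3, independent of i.
  obtain ⟨j, hj⟩ := norm_orbitPoly_affine_le hd hA hM (n + i)
  have h1 := hj t (ht.trans_le (norm_le_norm_orbitPoly hd ht.le _))
  have h2 := (norm_orbitPoly_distortion hd n ht' i).2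
  have h3 := (norm_orbitPoly_distortion hd n ht.le (i + j)).1
  rw [← add_assoc] at h3
  refine le_of_pow_le_pow_left₀ (n := d ^ j) (pow_ne_zero _ (by omega)) (by positivity) ?_
  calc ((‖(orbitPoly d n).eval (A * t + B)‖ - orbitError d n (A * t + B)) ^ d ^ i) ^ d ^ j
      ≤ ‖(orbitPoly d (n + i)).eval (A * t + B)‖ ^ d ^ j :=
        pow_le_pow_left₀ (pow_nonneg (by linarith) _) (by linarith) _
    _ ≤ 3 ^ d ^ j * ‖(orbitPoly d (n + i + j)).eval t‖ := h1
    _ ≤ 3 ^ d ^ j * (‖(orbitPoly d n).eval t‖ + orbitError d n t) ^ d ^ (i + j) := by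
        gcongr; linarith
    _ = _ := by rw [mul_pow, ← pow_mul, pow_add]

/-- The orbit polynomials are semi-invariant under affine maps preserving the multibrot set. -/
theorem orbitPoly_eval_affine {d : ℕ} (hd : 2 ≤ d) {A B : ℂ} (hA : ‖A‖ = 1)
    (hM : ∀ t ∈ multibrot d, A * t + B ∈ multibrot d) {n : ℕ} (hn : n ≠ 0) (t : ℂ) :
    (orbitPoly d n).eval (A * t + B) = A ^ d ^ n * (orbitPoly d n).eval t := by
  have hA0 : A ≠ 0 := by rintro rfl; simp at hA
  obtain ⟨hm, hdeg⟩ := orbitPoly_monic_natDegree hd n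
  have hlin : (C A * X + C B).natDegree = 1 := natDegree_linear hA0
  have hA1 : ‖A ^ d ^ n‖ = 1 := by simp [hA]
  have hA1' : A ^ d ^ n ≠ 0 := pow_ne_zero _ hA0
  have hlc : ((orbitPoly d n).comp (C A * X + C B)).leadingCoeff = A ^ d ^ n := by
    rw [leadingCoeff_comp (by rw [hlin]; exact one_ne_zero), leadingCoeff_linear hA0,
      hm.leadingCoeff, hdeg, one_mul]
  have hnd : ((orbitPoly d n).comp (C A * X + C B)).natDegree
      = (C (A ^ d ^ n) * orbitPoly d n).natDegree := by
    rw [natDegree_comp, hlin, mul_one, natDegree_C_mul hA1']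
  have hcomp0 : (orbitPoly d n).comp (C A * X + C B) ≠ 0 := by
    rw [← leadingCoeff_ne_zero, hlc]; exact hA1'
  have hμ : Tendsto (fun t => A * t + B) (cobounded ℂ) (cobounded ℂ) := by
    have := tendsto_norm_atTop (p := C A * X + C B)
      (natDegree_pos_iff_degree_pos.mp (by rw [hlin]; exact one_pos)) tendsto_norm_cobounded_atTop
    rw [← tendsto_norm_atTop_iff_cobounded]
    simpa using this
  have hε : Tendsto (fun t => orbitError d n t + orbitError d n (A * t + B)) (cobounded ℂ)
      (𝓝 0) := by
    simpa using (tendsto_orbitError hd hn).add ((tendsto_orbitError hd hn).comp hμ)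
  have key := eq_C_mul_of_norm_eval_le (p := orbitPoly d n)
    (q := (orbitPoly d n).comp (C A * X + C B)) hA1 hm.ne_zero ?_ hε ?_
  · simpa [eval_comp] using congrArg (eval t) key
  · rw [← degree_C_mul (p := orbitPoly d n) hA1']
    refine degree_sub_lt_right ?_ (by simp [hA0, hm.ne_zero]) ?_
    · rw [degree_eq_natDegree hcomp0, hnd, degree_eq_natDegree (by simp [hA0, hm.ne_zero])]
    · rw [hlc, leadingCoeff_mul, leadingCoeff_C, hm.leadingCoeff, mul_one]
  · have hbig : ∀ᶠ z : ℂ in cobounded ℂ, 2 < ‖z‖ :=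
      tendsto_norm_cobounded_atTop.eventually_gt_atTop 2
    filter_upwards [hbig, hμ.eventually hbig] with z h1 h2
    have := norm_orbitPoly_affine_sub_le hd hA hM n h1 h2.le
    simp only [eval_comp, eval_add, eval_mul, eval_C, eval_X]
    linarith

theorem exists_ne_zero_mem_multibrot {d : ℕ} (hd : 2 ≤ d) :
    (0 : ℂ) ∈ multibrot d ∧ ∃ t ∈ multibrot d, t ≠ 0 := by
  have h0 : (0 : ℂ) ∈ multibrot d := by
    rw [mem_multibrot_iff hd]
    intro n
    have : (orbitPoly d n).eval 0 = 0 := by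
      induction n with
      | zero => simp [orbitPoly]
      | succ n ih => rw [orbitPoly_eval_succ, ih, zero_pow (by omega), zero_add]
    simp [this]
  refine ⟨h0, ?_⟩
  -- For such t the critical orbit is the 2-cycle 0, t, 0, t, ….
  obtain ⟨t, ht⟩ := IsAlgClosed.exists_pow_nat_eq (-1 : ℂ) (by omega : 0 < d - 1)
  have htn : ‖t‖ = 1 := by
    refine (pow_eq_one_iff_of_nonneg (norm_nonneg t) (by omega : d - 1 ≠ 0)).mp ?_
    rw [← norm_pow, ht]; simp
  have htd : t ^ d = -t := by
    rw [← Nat.sub_add_cancel (by omega : 1 ≤ d), pow_succ, ht]; ring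
  refine ⟨t, (mem_multibrot_iff hd).mpr fun n => ?_, by rintro rfl; simp at htn⟩
  have : (orbitPoly d n).eval t = t ∨ (orbitPoly d n).eval t = 0 := by
    induction n with
    | zero => simp [orbitPoly]
    | succ n ih =>
      rw [orbitPoly_eval_succ]
      rcases ih with h | h
      · right; rw [h, htd]; ring
      · left; rw [h, zero_pow (by omega), zero_add]
  rcases this with h | h
  · rw [h, htn]; norm_num
  · simp [h]

theorem isBounded_multibrot {d : ℕ} (hd : 2 ≤ d) : IsBounded (multibrot d) :=
  isBounded_iff_forall_norm_le.mpr ⟨2, fun t ht => by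
    simpa [orbitPoly] using (mem_multibrot_iff hd).mp ht 0⟩

theorem norm_eq_one_of_image_multibrot {d : ℕ} (hd : 2 ≤ d) {A B : ℂ}
    (h : (fun z : ℂ => A * z + B) '' multibrot d = multibrot d) : ‖A‖ = 1 := by
  obtain ⟨h0, t, ht, ht0⟩ := exists_ne_zero_mem_multibrot hd
  have hpos : 0 < Metric.diam (multibrot d) :=
    Metric.diam_pos ⟨0, h0, t, ht, ht0.symm⟩ (isBounded_multibrot hd)
  have himg : (fun z : ℂ => A * z + B) '' multibrot d = (· + B) '' (A • multibrot d) := by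
    rw [← Set.image_smul, Set.image_image]; rfl
  have hdiam := congrArg Metric.diam h
  rw [himg, (isometry_add_right B).diam_image, diam_smul₀] at hdiam
  exact mul_right_cancel₀ hpos.ne' (hdiam.trans (one_mul _).symm)

theorem mul_mem_multibrot {d : ℕ} (hd : 2 ≤ d) {ξ t : ℂ} (hξ : ξ ^ (d - 1) = 1)
    (ht : t ∈ multibrot d) : ξ * t ∈ multibrot d := by
  have hn : ‖ξ‖ = 1 := by
    refine (pow_eq_one_iff_of_nonneg (norm_nonneg ξ) (by omega : d - 1 ≠ 0)).mp ?_
    rw [← norm_pow, hξ, norm_one]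
  have hξd : ξ ^ d = ξ := by
    rw [← Nat.sub_add_cancel (by omega : 1 ≤ d), pow_succ, hξ, one_mul]
  rw [mem_multibrot_iff hd] at ht ⊢
  intro n
  have : (orbitPoly d n).eval (ξ * t) = ξ * (orbitPoly d n).eval t := by
    induction n with
    | zero => simp [orbitPoly]
    | succ n ih => rw [orbitPoly_eval_succ, orbitPoly_eval_succ, ih, mul_pow, hξd]; ring
  rw [this, norm_mul, hn, one_mul]
  exact ht n

theorem mainTheorem3 (d : ℕ) (hd : 2 ≤ d) :
    (∀ A B : ℂ, (fun z : ℂ => A * z + B) '' multibrot d = multibrot d →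
      A ^ (d - 1) = 1 ∧ B = 0) ∧
    (∀ ξ : ℂ, ξ ^ (d - 1) = 1 → (fun z : ℂ => ξ * z) '' multibrot d = multibrot d) := by
  refine ⟨fun A B h => ?_, fun ξ hξ => ?_⟩
  · have hA := norm_eq_one_of_image_multibrot hd h
    have hA0 : A ≠ 0 := by rintro rfl; simp at hA
    have hM : ∀ t ∈ multibrot d, A * t + B ∈ multibrot d :=
      fun t ht => h.subset (Set.mem_image_of_mem _ ht)
    have h1 := orbitPoly_eval_affine hd hA hM one_ne_zero
    have h2 := orbitPoly_eval_affine hd hA hM two_ne_zero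
    have hlin : ∀ t, A * t + B = A ^ d ^ 2 * t := by
      intro t
      have h3 := h2 t
      -- By the case n = 1 the d-th powers on both sides agree and cancel.
      rw [orbitPoly_eval_succ d 1, orbitPoly_eval_succ d 1, h1, mul_pow, ← pow_mul, pow_one, ← sq] at h3
      linear_combination h3
    have hB : B = 0 := by simpa using hlin 0
    refine ⟨?_, hB⟩
    have h4 := h1 1
    simp only [hB, orbitPoly, eval_add, eval_pow, eval_X, pow_one, mul_one, add_zero,
      one_pow] at h4
    have h5 : A ^ (d - 1) * A = 1 * A := by
      rw [← pow_succ, Nat.sub_add_cancel (by omega)]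
      linear_combination -h4
    exact mul_right_cancel₀ hA0 h5
  · have hξ0 : ξ ≠ 0 := by
      rintro rfl
      rw [zero_pow (by omega)] at hξ
      exact zero_ne_one hξ
    refine Set.Subset.antisymm ?_ fun t ht => ⟨ξ⁻¹ * t, ?_, mul_inv_cancel_left₀ hξ0 t⟩
    · rintro _ ⟨t, ht, rfl⟩
      exact mul_mem_multibrot hd hξ ht
    · exact mul_mem_multibrot hd (by rw [inv_pow, hξ, inv_one]) ht
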